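/- **Conventions.** Composition is written from left to right. A *category with subobjects* is a small category $\mathcal C$ with a wide subcategory of morphisms, called *inclusions*, which is a strict preorder (at most one inclusion between two objects, written $j(c,d)\colon c\subseteq d$, and $c\subseteq d\subseteq c$ implies $c=d$), such that every inclusion is a monomorphism and $h$ is an inclusion whenever $hg$ and $g$ are. A *retraction* is a $q\colon c\to c'$ with $j(c',c)q=1_{c'}$ for some $c'\subseteq c$. A *normal factorization* of $f$ is $f=quj$ with $q$ a retraction, $u$ an isomorphism, $j$ an inclusion; $f^\circ=qu$ is the *epimorphic component*. A *normal cone* $\gamma$ with apex $c_\gamma$ is a family $\gamma(c)\colon c\to c_\gamma$ ($c\in v\mathcal C$) with $j(c,c')\gamma(c')=\gamma(c)$ for $c\subseteq c'$ and some $\gamma(c)$ an isomorphism; put $M\gamma=\{c:\gamma(c)\text{ is an isomorphism}\}$, and for an epimorphism $p$ with domain $c_\gamma$ let $\gamma*p$ be the cone $a\mapsto\gamma(a)p$. $\mathcal C$ is *normal* if every morphism has a normal factorization, every inclusion splits, and every object $c$ is the apex of a normal cone $\gamma$ with $\gamma(c)=1_c$. For a normal cone $\gamma$ in a normal category $\mathcal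 C$, the *H-functor* $H(\gamma;-)\colon\mathcal C\to\mathbf{Set}$ is $H(\gamma;c)=\{\gamma*f^\circ: f\in\mathcal C(c_\gamma,c)\}$, $H(\gamma;g)\colon\gamma*f^\circ\mapsto\gamma*(fg)^\circ$; $\eta_\gamma\colon H(\gamma;-)\to\mathcal C(c_\gamma,-)$, $\gamma*f^\circ\mapsto f$, is a natural isomorphism. Put $MH(\gamma;-)=M\gamma$. The *normal dual* $N^*\mathcal C$ is the full subcategory of $[\mathcal C,\mathbf{Set}]$ on the H-functors; its inclusions are the inclusions of functors (all components are inclusions of sets). The *ideal* $\langle c\rangle$ is the full subcategory on the objects $d\subseteq c$. A functor $F$ between normal categories is a *local isomorphism* if it preserves inclusions, is fully faithful, and restricts for each object $c$ to an isomorphism of $\langle c\rangle$ onto $\langle F(c)\rangle$. For normal categories $\mathcal D,\mathcal C$, a functor $\Gamma\colon\mathcal D\to N^*\mathcal C$ is a *cross-connection* if it is a local isomorphism and every $c\in v\mathcal C$ lies in $M\Gamma(d)$ for some $d\in v\mathcal D$. Let $S$ be a regular semigroup, $E$ its set of idempotents, and $\mathcal G(S)$ its groupoid: the objects are the elements of $E$,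 and the morphisms $e\to f$ are the pairs $(x,x')$ of mutually inverse elements with $xx'=e$, $x'x=f$. Write $e\,\omega^l f$ if $ef=e$, $e\,\omega^r f$ if $fe=e$, $\omega=\omega^l\cap\omega^r$, $\mathscr L=\omega^l\cap(\omega^l)^{-1}$, $\mathscr R=\omega^r\cap(\omega^r)^{-1}$, and $\overleftarrow e$, $\overrightarrow e$ for the $\mathscr L$- and $\mathscr R$-class of $e$ in $E$. The category $\mathcal L_G$ has object set $E/\mathscr L$. Its morphisms are those of the free category on the quiver with the arrows $r(e,u,f)\colon\overleftarrow e\to\overleftarrow f$ where either $u=e\,\omega^l f$, or $u\in E$ with $u\,\mathscr L\,f$ and $u\,\omega\,e$, or $(u,u')\colon e\to f$ is a morphism of $\mathcal G(S)$ for some $u'$; they are composed by $r(e,u,f)\,r(g,v,h)=r(e,uv,h)$ for $f\mathrel{\mathscr L}g$, the empty path at $\overleftarrow e$ being $r(e,e,e)$, and identified by $r(e,u,f)\sim r(g,v,h)\iff e\mathrel{\mathscr L}g,\ f\mathrel{\mathscr L}h,\ u=ev$. There is a morphism $r(e,u,f)$ for every $u\in eSf$. The inclusions are the $r(e,e,f)$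 with $e\,\omega^l f$. The category $\mathcal R_G$, with object set $E/\mathscr R$, morphisms $l(e,u,f)\colon\overrightarrow e\to\overrightarrow f$ ($u\in fSe$), composition $l(e,u,f)\,l(f,v,g)=l(e,vu,g)$ and inclusions $l(e,e,f)$ for $e\,\omega^r f$, is constructed dually, i.e. by the same construction from the opposite semigroup. For $e\in E$ let $r^e$ be the normal cone in $\mathcal L_G$ with apex $\overleftarrow e$ and $r^e(\overleftarrow g)=r(g,ge,e)$. **Theorem.** Let $S$ be a regular semigroup. There is exactly one functor $\Gamma_G\colon\mathcal R_G\to N^*\mathcal L_G$ such that $$\Gamma_G(\overrightarrow e)=H(r^e;-)\quad\text{and}\quad \Gamma_G(l(e,u,f))=\eta_{r^e}\,\mathcal L_G(r(f,u,e),-)\,\eta_{r^f}^{-1}$$ for all $e,f\in E$ and $u\in fSe$. This functor is a cross-connection: $\mathcal R_G$, $\mathcal L_G$ and $N^*\mathcal L_G$ are normal categories, $\Gamma_G$ is a local isomorphism, and every object of $\mathcal L_G$ lies in $M\Gamma_G(\overrightarrow e)$ for some $e\in E$. -/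

import Mathlib

open CategoryTheory

universe u

noncomputable section

namespace CrossConn

/-! ### Categories with subobjects and normal categories -/

/-- A category with a distinguished class of morphisms, the inclusions. -/
class HasInclusions (C : Type u) [SmallCategory C] where
  incl : MorphismProperty C

section General

variable {C : Type u} [SmallCategory C] [HasInclusions C]

/-- `IsIncl j`: the morphism `j` belongs to the distinguished class. -/
def IsIncl {c d : C} (j : c ⟶ d) : Prop := HasInclusions.incl j

/-- `Sub c d` is the relation `c ⊆ d`: there is an inclusion from `c` to `d`. -/
def Sub (c d : C) : Prop := ∃ j : c ⟶ d, IsIncl j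

/-- `q : c ⟶ c'` is a retraction: it splits an inclusion `c' ⊆ c`. -/
def IsRetraction {c c' : C} (q : c ⟶ c') : Prop := ∃ i : c' ⟶ c, IsIncl i ∧ i ≫ q = 𝟙 c'

variable (C) in
/-- A category with subobjects: the inclusions form a wide subcategory which is a strict
preorder, every inclusion is a monomorphism, and `h` is an inclusion as soon as `g` and
`h ≫ g` are. -/
class IsCatWithSubobjects : Prop where
  id_mem : ∀ c : C, IsIncl (𝟙 c)
  comp_mem : ∀ {a b c : C} (f : a ⟶ b) (g : b ⟶ c), IsIncl f → IsIncl g → IsIncl (f ≫ g)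
  unique : ∀ {a b : C} (f g : a ⟶ b), IsIncl f → IsIncl g → f = g
  strict : ∀ {a b : C} (f : a ⟶ b) (g : b ⟶ a), IsIncl f → IsIncl g → a = b
  mono : ∀ {a b : C} (f : a ⟶ b), IsIncl f → Mono f
  of_comp : ∀ {a b c : C} (h : a ⟶ b) (g : b ⟶ c), IsIncl (h ≫ g) → IsIncl g → IsIncl h

/-- A normal factorization `f = q u j`: a retraction, an isomorphism and an inclusion. -/
structure NormalFactorization {c d : C} (f : c ⟶ d) where
  mid : C
  im : C
  q : c ⟶ mid
  u : mid ⟶ im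
  j : im ⟶ d
  retraction : IsRetraction q
  iso : IsIso u
  inclusion : IsIncl j
  fac : q ≫ u ≫ j = f

variable (C) in
/-- A normal cone with base `C` and the given apex. -/
@[ext]
structure NormalCone where
  apex : C
  app : ∀ c : C, c ⟶ apex
  incl_comp : ∀ {c c' : C} (j : c ⟶ c'), IsIncl j → j ≫ app c' = app c
  exists_iso : ∃ c : C, IsIso (app c)

variable (C) in
/-- Normal categories. -/
class IsNormalCategory : Prop extends IsCatWithSubobjects C where
  factorization : ∀ {c d : C} (f : c ⟶ d), Nonempty (NormalFactorization f)
  splits : ∀ {c d : C} (j : c ⟶ d), IsIncl j → ∃ q : d ⟶ c, j ≫ q = 𝟙 c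
  cone : ∀ c : C, ∃ (γ : NormalCone C) (h : γ.apex = c), γ.app c = eqToHom h.symm

/-- The `M`-set of a normal cone. -/
def NormalCone.M (γ : NormalCone C) : Set C := {c | IsIso (γ.app c)}

section Normal

variable [IsNormalCategory C]

/-- A chosen normal factorization; its epimorphic component and its inclusion do not depend on
the choice, see `factor_unique`. -/
def factorOf {c d : C} (f : c ⟶ d) : NormalFactorization f :=
  (IsNormalCategory.factorization f).some

/-- The codomain of the epimorphic component of `f`. -/
abbrev im {c d : C} (f : c ⟶ d) : C := (factorOf f).im

/-- The epimorphic component `f° = q u` of `f = q u j`. -/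
def epiPart {c d : C} (f : c ⟶ d) : c ⟶ im f := (factorOf f).q ≫ (factorOf f).u

/-- The inclusion `j` of `f = f° j`. -/
def imIncl {c d : C} (f : c ⟶ d) : im f ⟶ d := (factorOf f).j

theorem epiPart_comp {c d : C} (f : c ⟶ d) : epiPart f ≫ imIncl f = f := by
  rw [epiPart, imIncl, Category.assoc]
  exact (factorOf f).fac

theorem imIncl_incl {c d : C} (f : c ⟶ d) : IsIncl (imIncl f) := (factorOf f).inclusion

theorem epiPart_split {c d : C} (f : c ⟶ d) : ∃ s : im f ⟶ c, s ≫ epiPart f = 𝟙 (im f) := by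
  obtain ⟨i, _, hi⟩ := (factorOf f).retraction
  have := (factorOf f).iso
  refine ⟨inv (factorOf f).u ≫ i, ?_⟩
  rw [epiPart, Category.assoc, reassoc_of% hi, IsIso.inv_hom_id]

instance epiPart_epi {c d : C} (f : c ⟶ d) : Epi (epiPart f) := by
  obtain ⟨s, hs⟩ := epiPart_split f
  exact ⟨fun g h e => by
    have := congrArg (fun t => s ≫ t) e
    simpa [reassoc_of% hs] using this⟩

/-- A factorization as a split epimorphism followed by an inclusion is unique. -/
theorem factor_unique {c d a b : C} (p : c ⟶ a) (j : a ⟶ d) (p' : c ⟶ b) (j' : b ⟶ d)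
    (hp : ∃ s, s ≫ p = 𝟙 a) (hp' : ∃ s, s ≫ p' = 𝟙 b) (hj : IsIncl j) (hj' : IsIncl j')
    (e : p ≫ j = p' ≫ j') : ∃ h : a = b, p ≫ eqToHom h = p' ∧ j = eqToHom h ≫ j' := by
  obtain ⟨s, hs⟩ := hp
  obtain ⟨s', hs'⟩ := hp'
  have h1 : (s ≫ p') ≫ j' = j := by rw [Category.assoc, ← e, reassoc_of% hs]
  have h2 : (s' ≫ p) ≫ j = j' := by rw [Category.assoc, e, reassoc_of% hs']
  have i1 : IsIncl (s ≫ p') := IsCatWithSubobjects.of_comp _ j' (by rw [h1]; exact hj) hj'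
  have i2 : IsIncl (s' ≫ p) := IsCatWithSubobjects.of_comp _ j (by rw [h2]; exact hj') hj
  obtain rfl := IsCatWithSubobjects.strict _ _ i1 i2
  obtain rfl := IsCatWithSubobjects.unique _ _ hj hj'
  have := IsCatWithSubobjects.mono j hj
  exact ⟨rfl, by simpa using (cancel_mono j).1 e, by simp⟩

/-- For a normal cone `γ` and an epimorphism `p` from its apex, the normal cone
`γ * p : a ↦ γ(a) p`. -/
def NormalCone.star (γ : NormalCone C) {d : C} (p : γ.apex ⟶ d) [Epi p] : NormalCone C where
  apex := d
  app c := γ.app c ≫ p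
  incl_comp j hj := by rw [← Category.assoc, γ.incl_comp j hj]
  exists_iso := by
    obtain ⟨c, hc⟩ := γ.exists_iso
    obtain ⟨s, hs⟩ : ∃ s : d ⟶ γ.apex, s ≫ p = 𝟙 d := by
      obtain ⟨r, hr⟩ := IsNormalCategory.splits _ (imIncl_incl p)
      obtain ⟨s, hs⟩ := epiPart_split p
      refine ⟨r ≫ s, ?_⟩
      have : Epi (epiPart p ≫ imIncl p) := by rw [epiPart_comp]; infer_instance
      have : Epi (imIncl p) := epi_of_epi (epiPart p) (imIncl p)
      have h1 : r ≫ imIncl p = 𝟙 d := by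
        rw [← cancel_epi (imIncl p), reassoc_of% hr, Category.comp_id]
      calc (r ≫ s) ≫ p = r ≫ (s ≫ epiPart p) ≫ imIncl p := by
            rw [Category.assoc, Category.assoc, epiPart_comp]
        _ = 𝟙 d := by rw [hs, Category.id_comp, h1]
    -- `m : d ⟶ c` is a section of `γ(c) p`; its image is the object we look for
    let m : d ⟶ c := s ≫ inv (γ.app c)
    have hm : m ≫ γ.app c ≫ p = 𝟙 d := by simp [m, hs]
    obtain ⟨t, ht⟩ := epiPart_split m
    have e1 : epiPart m ≫ imIncl m ≫ γ.app c ≫ p = 𝟙 d := by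
      rw [← Category.assoc, epiPart_comp, hm]
    have e2 : (imIncl m ≫ γ.app c ≫ p) ≫ epiPart m = 𝟙 _ := by
      rw [← cancel_epi (epiPart m)]
      rw [← Category.assoc, e1, Category.id_comp, Category.comp_id]
    refine ⟨im m, ?_⟩
    rw [← γ.incl_comp _ (imIncl_incl m), Category.assoc]
    exact ⟨⟨epiPart m, e2, e1⟩⟩

/-- The map `f ↦ γ * f°` on `C(c_γ, c)`. -/
def NormalCone.starEpi (γ : NormalCone C) (c : C) (f : γ.apex ⟶ c) : NormalCone C :=
  γ.star (epiPart f)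

theorem NormalCone.starEpi_injective (γ : NormalCone C) (c : C) :
    Function.Injective (γ.starEpi c) := by
  intro f g h
  obtain ⟨a, ha⟩ := γ.exists_iso
  have key : ∀ (x y : C) (p : γ.apex ⟶ x) (p' : γ.apex ⟶ y) (j : x ⟶ c) (j' : y ⟶ c)
      [Epi p] [Epi p'], IsIncl j → IsIncl j' → γ.star p = γ.star p' → p ≫ j = p' ≫ j' := by
    intro x y p p' j j' _ _ hj hj' e
    obtain rfl : x = y := congrArg NormalCone.apex e
    obtain rfl := IsCatWithSubobjects.unique _ _ hj hj'
    have e2 : (γ.star p).app = (γ.star p').app := by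
      simpa [NormalCone.ext_iff, star] using e
    have e3 : γ.app a ≫ p = γ.app a ≫ p' := congrFun e2 a
    rw [(cancel_epi (γ.app a)).1 e3]
  have := key _ _ _ _ _ _ (imIncl_incl f) (imIncl_incl g) h
  rwa [epiPart_comp, epiPart_comp] at this

end Normal

/-! ### H-functors and the normal dual -/

variable (C) in
/-- A functor from `C` to sets all of whose values are sets of normal cones in `C`.  The values
are kept as sets, not just as types, so that equality and inclusion of such functors are those
of set-valued functors. -/
structure ConeFunctor where
  obj : C → Set (NormalCone C)
  map : ∀ {c d : C}, (c ⟶ d) → obj c → obj d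
  map_id : ∀ (c : C) (x : obj c), map (𝟙 c) x = x
  map_comp : ∀ {a b c : C} (f : a ⟶ b) (g : b ⟶ c) (x : obj a),
    map (f ≫ g) x = map g (map f x)

/-- The underlying functor to the category of types. -/
def ConeFunctor.toFunctor (F : ConeFunctor C) : C ⥤ Type u where
  obj c := F.obj c
  map g := ↾(F.map g)
  map_id c := ConcreteCategory.hom_ext _ _ fun x => F.map_id c x
  map_comp f g := ConcreteCategory.hom_ext _ _ fun x => F.map_comp f g x

section Normal

variable [IsNormalCategory C]

/-- The bijection `f ↦ γ * f°` from `C(c_γ, c)` onto `{γ * f° | f ∈ C(c_γ, c)}`. -/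
def NormalCone.starEquiv (γ : NormalCone C) (c : C) :
    (γ.apex ⟶ c) ≃ Set.range (γ.starEpi c) :=
  Equiv.ofInjective _ (γ.starEpi_injective c)

/-- The H-functor `H(γ; -)`: it sends `c` to `{γ * f° | f ∈ C(c_γ, c)}` and `g` to the map
`γ * f° ↦ γ * (f g)°`. -/
def NormalCone.H (γ : NormalCone C) : ConeFunctor C where
  obj c := Set.range (γ.starEpi c)
  map {c d} g x := γ.starEquiv d ((γ.starEquiv c).symm x ≫ g)
  map_id c x := by simp
  map_comp f g x := by simp

/-- The natural isomorphism `η_γ : H(γ; -) ≅ C(c_γ, -)`, `γ * f° ↦ f`. -/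
def NormalCone.η (γ : NormalCone C) :
    γ.H.toFunctor ≅ coyoneda.obj (Opposite.op γ.apex) :=
  NatIso.ofComponents (fun c => (γ.starEquiv c).symm.toIso) fun {c d} g =>
    ConcreteCategory.hom_ext _ _ fun x =>
      (γ.starEquiv d).symm_apply_apply ((γ.starEquiv c).symm x ≫ g)

variable (C) in
/-- The objects of the normal dual `N*C`: the H-functors. -/
structure NormalDual where
  fn : ConeFunctor C
  isH : ∃ γ : NormalCone C, fn = γ.H

/-- The morphisms of `N*C` are all natural transformations between H-functors. -/
@[ext]
structure NormalDual.Hom (F G : NormalDual C) where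
  nat : F.fn.toFunctor ⟶ G.fn.toFunctor

/-- The normal dual, a full subcategory of the category of functors from `C` to sets. -/
instance : SmallCategory (NormalDual C) where
  Hom F G := NormalDual.Hom F G
  id F := ⟨𝟙 _⟩
  comp σ τ := ⟨σ.nat ≫ τ.nat⟩

/-- The map of sets of normal cones given by a component of a morphism of `N*C`. -/
def NormalDual.comp {F G : NormalDual C} (σ : F ⟶ G) (c : C) : F.fn.obj c → G.fn.obj c :=
  fun x => (NormalDual.Hom.nat σ).app c x

/-- The inclusions of `N*C` are the inclusions of functors: all components are
inclusions of sets. -/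
instance : HasInclusions (NormalDual C) where
  incl _ _ σ := ∀ c x, (NormalDual.comp σ c x).1 = x.1

/-- `H(γ; -)` as an object of `N*C`. -/
abbrev NormalCone.HObj (γ : NormalCone C) : NormalDual C := ⟨γ.H, γ, rfl⟩

/-- The `M`-set of an H-functor `H(γ; -)` is that of `γ`. -/
def NormalDual.M (F : NormalDual C) : Set C :=
  {c | ∃ γ : NormalCone C, F.fn = γ.H ∧ c ∈ γ.M}

end Normal

/-! ### Local isomorphisms and cross-connections -/

/-- The objects of the ideal `⟨c⟩`, a full subcategory. -/
def ideal (c : C) : ObjectProperty C := fun d => Sub d c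

/-- An isomorphism of categories: a functor bijective on objects and fully faithful. -/
structure IsCatIso {A B : Type u} [SmallCategory A] [SmallCategory B] (F : A ⥤ B) : Prop where
  bij : Function.Bijective F.obj
  full : F.Full
  faithful : F.Faithful

variable {D : Type u} [SmallCategory D] [HasInclusions D]

/-- The restriction of an inclusion preserving functor to a functor `⟨c⟩ ⥤ ⟨F c⟩`. -/
def restrictIdeal (F : C ⥤ D) (hF : ∀ {a b : C} (j : a ⟶ b), IsIncl j → IsIncl (F.map j))
    (c : C) : (ideal c).FullSubcategory ⥤ (ideal (F.obj c)).FullSubcategory :=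
  (ideal (F.obj c)).lift ((ideal c).ι ⋙ F) fun X => by
    obtain ⟨j, hj⟩ := X.property
    exact ⟨F.map j, hF j hj⟩

/-- Local isomorphisms between normal categories. -/
structure IsLocalIso (F : C ⥤ D) : Prop where
  normal_source : IsNormalCategory C
  normal_target : IsNormalCategory D
  map_incl : ∀ {a b : C} (j : a ⟶ b), IsIncl j → IsIncl (F.map j)
  full : F.Full
  faithful : F.Faithful
  iso_ideal : ∀ c : C, IsCatIso (restrictIdeal F map_incl c)

/-- `(D, C; Γ)` is a cross-connection from `D` to `C`. -/
structure IsCrossConnection [IsNormalCategory C] (Γ : D ⥤ NormalDual C) : Prop where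
  normal_source : IsNormalCategory D
  localIso : IsLocalIso Γ
  exists_mem_M : ∀ c : C, ∃ d : D, c ∈ (Γ.obj d).M

end General

/-! ### Regular semigroups and the groupoid of a regular semigroup -/

/-- Regular semigroups: every element has an inverse. -/
class IsRegularSemigroup (S : Type u) [Semigroup S] : Prop where
  exists_inverse : ∀ a : S, ∃ b : S, a * b * a = a ∧ b * a * b = b

instance (S : Type u) [Semigroup S] [IsRegularSemigroup S] : IsRegularSemigroup Sᵐᵒᵖ where
  exists_inverse a := by
    obtain ⟨b, h1, h2⟩ := IsRegularSemigroup.exists_inverse a.unop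
    exact ⟨MulOpposite.op b, MulOpposite.unop_injective (by simp [← mul_assoc, h1]),
      MulOpposite.unop_injective (by simp [← mul_assoc, h2])⟩

/-- The set `E(S)` of idempotents. -/
abbrev E (S : Type u) [Semigroup S] : Type u := {e : S // IsIdempotentElem e}

section LG

variable {S : Type u} [Semigroup S]

/-- The quasi-order `ω^l`: `e f = e`. -/
def omegaL (e f : E S) : Prop := e.1 * f.1 = e.1

/-- The quasi-order `ω^r`: `f e = e`. -/
def omegaR (e f : E S) : Prop := f.1 * e.1 = e.1

variable (S) in
/-- The relation `ℒ = ω^l ∩ (ω^l)⁻¹` on `E(S)`. -/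
def setoidL : Setoid (E S) where
  r e f := omegaL e f ∧ omegaL f e
  iseqv :=
    { refl := fun e => ⟨e.2, e.2⟩
      symm := fun h => ⟨h.2, h.1⟩
      trans := by
        rintro e f g ⟨h1, h2⟩ ⟨h3, h4⟩
        simp only [omegaL] at *
        exact ⟨by rw [← h1, mul_assoc, h3], by rw [← h4, mul_assoc, h2]⟩ }

/-- A morphism `(x, x')` of `𝒢(S)` from `e` to `f`: `x'` is an inverse of `x`, `x x' = e` and
`x' x = f`. -/
@[ext]
structure GHom (e f : E S) where
  x : S
  x' : S
  inv_left : x * x' * x = x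
  inv_right : x' * x * x' = x'
  dom : x * x' = e.1
  cod : x' * x = f.1

variable (S) in
/-- The objects of `𝒢(S)`. -/
def GObj : Type u := E S

/-- The groupoid `𝒢(S)`, with `(x, x') (y, y') = (x y, y' x')` and `(x, x')⁻¹ = (x', x)`. -/
instance : Groupoid.{u} (GObj S) where
  Hom e f := GHom (S := S) e f
  id e := ⟨e.1, e.1, by rw [e.2, e.2], by rw [e.2, e.2], e.2, e.2⟩
  comp {e f g} p q :=
    have h1 : p.x * q.x * (q.x' * p.x') = e.1 := by
      rw [← p.dom, mul_assoc, ← mul_assoc q.x, q.dom, ← p.cod, ← mul_assoc, ← mul_assoc,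
        p.inv_left]
    have h2 : q.x' * p.x' * (p.x * q.x) = g.1 := by
      rw [← q.cod, mul_assoc, ← mul_assoc p.x', p.cod, ← q.dom, ← mul_assoc, ← mul_assoc,
        q.inv_right]
    ⟨p.x * q.x, q.x' * p.x', by rw [h1, ← p.dom, ← mul_assoc, p.inv_left],
      by rw [h2, ← q.cod, ← mul_assoc, q.inv_right], h1, h2⟩
  id_comp {e f} p := by
    ext
    · change e.1 * p.x = p.x; rw [← p.dom, p.inv_left]
    · change p.x' * e.1 = p.x'; rw [← p.dom, ← mul_assoc, p.inv_right]
  comp_id {e f} p := by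
    ext
    · change p.x * f.1 = p.x; rw [← p.cod, ← mul_assoc, p.inv_left]
    · change f.1 * p.x' = p.x'; rw [← p.cod, p.inv_right]
  assoc p q r := by
    ext
    · exact mul_assoc _ _ _
    · exact (mul_assoc _ _ _).symm
  inv p := ⟨p.x', p.x, p.inv_right, p.inv_left, p.cod, p.dom⟩
  inv_comp {e f} p := by
    ext
    · exact p.cod
    · exact p.cod
  comp_inv {e f} p := by
    ext
    · exact p.dom
    · exact p.dom

/-! ### The quiver `ℒ_Q` and the category `ℒ_G` -/

/-- `(e, u, f)` is a morphism `j(e, f) = j(e, e, f)` of `𝒫_L`, where `e ω^l f`. -/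
def InPL (e : E S) (u : S) (f : E S) : Prop := omegaL e f ∧ u = e.1

/-- `(e, u, f)` is a morphism `q(e, u, f)` of `𝒬_L`, where `u` is an idempotent,
`u ℒ f` and `u ω e`. -/
def InQL (e : E S) (u : S) (f : E S) : Prop :=
  ∃ h : E S, u = h.1 ∧ (setoidL S).r h f ∧ omegaL h e ∧ omegaR h e

/-- `(e, u, f)` is a morphism `g(e, x, f)` of `𝒢_L`, coming from a morphism `(x, x')` of
`𝒢(S)` from `e` to `f`. -/
def InGL (e : E S) (u : S) (f : E S) : Prop :=
  ∃ p : @Quiver.Hom (GObj S) _ e f, u = GHom.x p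

variable (S) in
/-- The vertices of the quiver `ℒ_Q`: the set `E/ℒ`. -/
def LQ : Type u := Quotient (setoidL S)

/-- The `ℒ`-class of an idempotent. -/
def LQ.mk (e : E S) : LQ S := Quotient.mk (setoidL S) e

/-- An arrow `r(e, u, f)` of `ℒ_Q = 𝒫_L ∪ 𝒬_L ∪ 𝒢_L` from the class of `e` to that of `f`. -/
structure LArrow (a b : LQ S) where
  src : E S
  val : S
  tgt : E S
  src_eq : LQ.mk src = a
  tgt_eq : LQ.mk tgt = b
  mem : InPL src val tgt ∨ InQL src val tgt ∨ InGL src val tgt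

instance : Quiver.{u} (LQ S) where
  Hom a b := LArrow a b

/-- A path of arrows `r(e₁, u₁, f₁) ⋯ r(eₙ, uₙ, fₙ)` starting at the class of `e`
composes to `r(e, e u₁ ⋯ uₙ, fₙ)`; this is its middle entry, which is `u₁ ⋯ uₙ` if `e = e₁`.
The empty path at the class of `e` is `r(e, e, e)`. -/
def pathVal (e : E S) {a : LQ S} : ∀ {b : LQ S}, Quiver.Path a b → S
  | _, .nil => e.1
  | _, .cons p r => pathVal e p * LArrow.val r

theorem LArrow.src_mul {a b : LQ S} (r : LArrow a b) : r.src.1 * r.val = r.val := by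
  rcases r.mem with ⟨_, h⟩ | ⟨h, e, _, _, h2⟩ | ⟨p, h⟩
  · rw [h]; exact r.src.2
  · rw [e]; exact h2
  · rw [h, ← GHom.dom p]; exact p.inv_left

theorem LArrow.mul_tgt {a b : LQ S} (r : LArrow a b) : r.val * r.tgt.1 = r.val := by
  rcases r.mem with ⟨h1, h⟩ | ⟨h, e, h1, _, _⟩ | ⟨p, h⟩
  · rw [h]; exact h1
  · rw [e]; exact h1.1
  · rw [h, ← GHom.cod p, ← mul_assoc]; exact p.inv_left

theorem LQ.mk_eq {e f : E S} : LQ.mk e = LQ.mk f ↔ e.1 * f.1 = e.1 ∧ f.1 * e.1 = f.1 :=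
  Quotient.eq (r := setoidL S)

theorem pathVal_mul {a b : LQ S} (p : Quiver.Path a b) (e f : E S) (he : LQ.mk e = a)
    (hf : LQ.mk f = b) : pathVal e p * f.1 = pathVal e p := by
  cases p with
  | nil => exact (LQ.mk_eq.1 (he.trans hf.symm)).1
  | cons p r =>
    have h := (LQ.mk_eq.1 ((LArrow.tgt_eq r).trans hf.symm)).1
    simp only [pathVal]
    rw [mul_assoc, ← LArrow.mul_tgt r, mul_assoc, h]

theorem pathVal_change {a b : LQ S} (p : Quiver.Path a b) (e g : E S) (he : LQ.mk e = a)
    (hg : LQ.mk g = a) : e.1 * pathVal g p = pathVal e p := by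
  induction p with
  | nil => exact (LQ.mk_eq.1 (he.trans hg.symm)).1
  | cons p r ih => simp only [pathVal]; rw [← mul_assoc, ih]

theorem pathVal_comp {a b c : LQ S} (p : Quiver.Path a b) (q : Quiver.Path b c) (e f : E S)
    (he : LQ.mk e = a) (hf : LQ.mk f = b) :
    pathVal e (p.comp q) = pathVal e p * pathVal f q := by
  induction q with
  | nil => exact (pathVal_mul p e f he hf).symm
  | cons q r ih => simp only [pathVal, Quiver.Path.comp_cons]; rw [ih, mul_assoc]

/-- The relation `∼` on the morphisms of the free category on `ℒ_Q`:
`r(e, u, f) ∼ r(g, v, h)` iff `e ℒ g`, `f ℒ h` and `u = e v`.  For two paths with the same end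
points the conditions `e ℒ g` and `f ℒ h` hold automatically. -/
def pathSetoid (a b : LQ S) : Setoid (Quiver.Path a b) where
  r p q := ∀ e g : E S, LQ.mk e = a → LQ.mk g = a → pathVal e p = e.1 * pathVal g q
  iseqv :=
    { refl := fun p e g he hg => (pathVal_change p e g he hg).symm
      symm := fun {p q} h e g he hg => by
        rw [pathVal_change p e g he hg, h e e he he, pathVal_change q e e he he]
      trans := fun {p q r} h1 h2 e g he hg => by
        rw [h1 e e he he, pathVal_change q e e he he, h2 e g he hg] }

theorem pathSetoid_iff {a b : LQ S} {p q : Quiver.Path a b} :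
    (pathSetoid a b).r p q ↔ ∀ e : E S, LQ.mk e = a → pathVal e p = pathVal e q := by
  constructor
  · intro h e he
    rw [h e e he he, pathVal_change q e e he he]
  · intro h e g he hg
    rw [h e he, pathVal_change q e g he hg]

variable (S) in
/-- The objects of `ℒ_G`: the set `E/ℒ`. -/
structure LG : Type u where
  cls : LQ S

/-- The object of `ℒ_G` given by the `ℒ`-class of `e`. -/
def LG.mk' (e : E S) : LG S := ⟨LQ.mk e⟩

theorem LQ.exists_rep (a : LQ S) : ∃ e : E S, LQ.mk e = a := Quotient.exists_rep a

/-- The category `ℒ_G`: the quotient of the free category on the quiver `ℒ_Q` by `∼`. -/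
instance : SmallCategory (LG S) where
  Hom a b := Quotient (pathSetoid a.cls b.cls)
  id a := Quotient.mk _ Quiver.Path.nil
  comp {a b c} p q := Quotient.map₂ (fun p q => Quiver.Path.comp p q) (by
    intro p p' hp q q' hq
    obtain ⟨f, hf⟩ := LQ.exists_rep b.cls
    refine pathSetoid_iff.2 fun e he => ?_
    rw [pathVal_comp p q e f he hf, pathVal_comp p' q' e f he hf, pathSetoid_iff.1 hp e he,
      pathSetoid_iff.1 hq f hf]) p q
  id_comp p := by
    refine Quotient.inductionOn p fun p => ?_
    exact congrArg (Quotient.mk _) (Quiver.Path.nil_comp p)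
  comp_id p := by
    refine Quotient.inductionOn p fun p => ?_
    exact congrArg (Quotient.mk _) (Quiver.Path.comp_nil p)
  assoc p q r := by
    refine Quotient.inductionOn₃ p q r fun p q r => ?_
    exact congrArg (Quotient.mk _) (Quiver.Path.comp_assoc p q r)

/-- The morphism of `ℒ_G` given by an arrow of the quiver `ℒ_Q`. -/
def LG.ofArrow {a b : LG S} (r : LArrow a.cls b.cls) : a ⟶ b :=
  Quotient.mk (pathSetoid a.cls b.cls) (Quiver.Hom.toPath (V := LQ S) r)

/-- The middle entry `u` of a morphism `r(e, u, f)` of `ℒ_G`, for a representative `e` of its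
domain. -/
def LG.val {a b : LG S} (e : E S) (he : LG.mk' e = a) (m : a ⟶ b) : S :=
  Quotient.lift (s := pathSetoid a.cls b.cls) (fun p => pathVal e p)
    (fun _ _ h => pathSetoid_iff.1 h e (congrArg LG.cls he)) m

theorem LG.hom_ext {a b : LG S} (e : E S) (he : LG.mk' e = a) {m n : a ⟶ b}
    (h : LG.val e he m = LG.val e he n) : m = n := by
  revert h
  refine Quotient.inductionOn₂ m n fun p q h => Quotient.sound (pathSetoid_iff.2 fun g hg => ?_)
  change pathVal e p = pathVal e q at h
  have he' : LQ.mk e = a.cls := congrArg LG.cls he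
  rw [← pathVal_change p g e hg he', h, pathVal_change q g e hg he']

theorem LG.val_id {a : LG S} (e : E S) (he : LG.mk' e = a) : LG.val e he (𝟙 a) = e.1 := rfl

theorem LG.val_comp {a b c : LG S} (e f : E S) (he : LG.mk' e = a) (hf : LG.mk' f = b)
    (m : a ⟶ b) (n : b ⟶ c) : LG.val e he (m ≫ n) = LG.val e he m * LG.val f hf n :=
  Quotient.inductionOn₂ m n fun p q =>
    pathVal_comp p q e f (congrArg LG.cls he) (congrArg LG.cls hf)

theorem LG.val_mul {a b : LG S} (e f : E S) (he : LG.mk' e = a) (hf : LG.mk' f = b)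
    (m : a ⟶ b) : LG.val e he m * f.1 = LG.val e he m :=
  Quotient.inductionOn m fun p => pathVal_mul p e f (congrArg LG.cls he) (congrArg LG.cls hf)

theorem LG.val_change {a b : LG S} (e g : E S) (he : LG.mk' e = a) (hg : LG.mk' g = a)
    (m : a ⟶ b) : e.1 * LG.val g hg m = LG.val e he m :=
  Quotient.inductionOn m fun p =>
    pathVal_change p e g (congrArg LG.cls he) (congrArg LG.cls hg)

theorem LG.mul_val {a b : LG S} (e : E S) (he : LG.mk' e = a) (m : a ⟶ b) :
    e.1 * LG.val e he m = LG.val e he m := LG.val_change e e he he m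

theorem LG.val_ofArrow {a b : LG S} (e : E S) (he : LG.mk' e = a) (r : LArrow a.cls b.cls) :
    LG.val e he (LG.ofArrow r) = e.1 * r.val := rfl

theorem LG.exists_rep (a : LG S) : ∃ e : E S, LG.mk' e = a := by
  obtain ⟨e, he⟩ := LQ.exists_rep a.cls
  exact ⟨e, by cases a; exact congrArg LG.mk he⟩

theorem LG.mk'_eq {e f : E S} :
    LG.mk' e = LG.mk' f ↔ e.1 * f.1 = e.1 ∧ f.1 * e.1 = f.1 := by
  rw [← LQ.mk_eq]
  exact ⟨fun h => congrArg LG.cls h, fun h => congrArg LG.mk h⟩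

/-- The inclusions of `ℒ_G` are the morphisms `j(e, f) = r(e, e, f)` of `𝒫_L`. -/
instance : HasInclusions (LG S) where
  incl a b m := ∃ r : LArrow a.cls b.cls, InPL r.src r.val r.tgt ∧ m = LG.ofArrow r

/-- `u ∈ e S f`. -/
def InESF (e : E S) (u : S) (f : E S) : Prop := ∃ s : S, u = e.1 * s * f.1

theorem InESF.left {e f : E S} {u : S} (h : InESF e u f) : e.1 * u = u := by
  obtain ⟨s, rfl⟩ := h
  rw [← mul_assoc, ← mul_assoc, e.2]

theorem InESF.right {e f : E S} {u : S} (h : InESF e u f) : u * f.1 = u := by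
  obtain ⟨s, rfl⟩ := h
  rw [mul_assoc, f.2]

theorem InESF.of {e f : E S} {u : S} (h : e.1 * u = u) (h' : u * f.1 = u) : InESF e u f :=
  ⟨u, by rw [h, h']⟩

theorem exists_inverse_below [IsRegularSemigroup S] {e f : E S} {u : S} (hu : InESF e u f) :
    ∃ v : S, u * v * u = u ∧ v * u * v = v ∧ v * e.1 = v := by
  obtain ⟨w, h1, h2⟩ := IsRegularSemigroup.exists_inverse u
  refine ⟨w * e.1, ?_, ?_, ?_⟩
  · rw [mul_assoc, mul_assoc, hu.left, ← mul_assoc, h1]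
  · rw [mul_assoc w, hu.left, ← mul_assoc, h2]
  · rw [mul_assoc, e.2]

/-- For `u ∈ e S f`, an inverse `v` of `u` with `v e = v`; then
`g = u v` is an idempotent in `R_u ∩ ω(e)` and `h = v u` is an idempotent in `L_u`. -/
def invBelow [IsRegularSemigroup S] {e f : E S} {u : S} (hu : InESF e u f) : S :=
  (exists_inverse_below hu).choose

theorem invBelow_spec [IsRegularSemigroup S] {e f : E S} {u : S} (hu : InESF e u f) :
    u * invBelow hu * u = u ∧ invBelow hu * u * invBelow hu = invBelow hu ∧
      invBelow hu * e.1 = invBelow hu :=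
  (exists_inverse_below hu).choose_spec

/-- The idempotent `g ∈ E(R_u) ∩ ω(e)`. -/
def gOf [IsRegularSemigroup S] {e f : E S} {u : S} (hu : InESF e u f) : E S :=
  ⟨u * invBelow hu, by
    change u * invBelow hu * (u * invBelow hu) = _
    rw [← mul_assoc, (invBelow_spec hu).1]⟩

/-- The idempotent `h ∈ E(L_u)`. -/
def hOf [IsRegularSemigroup S] {e f : E S} {u : S} (hu : InESF e u f) : E S :=
  ⟨invBelow hu * u, by
    change invBelow hu * u * (invBelow hu * u) = _
    rw [← mul_assoc, (invBelow_spec hu).2.1]⟩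

/-- The retraction `r(e, g, g)`. -/
def arrowQ [IsRegularSemigroup S] {a : LG S} {e f : E S} {u : S} (he : LG.mk' e = a)
    (hu : InESF e u f) : LArrow a.cls (LG.mk' (gOf hu)).cls where
  src := e
  val := (gOf hu).1
  tgt := gOf hu
  src_eq := congrArg LG.cls he
  tgt_eq := rfl
  mem := Or.inr <| Or.inl ⟨gOf hu, rfl, (setoidL S).refl _,
    by change u * invBelow hu * e.1 = u * invBelow hu; rw [mul_assoc, (invBelow_spec hu).2.2],
    by change e.1 * (u * invBelow hu) = u * invBelow hu; rw [← mul_assoc, hu.left]⟩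

/-- The isomorphism `r(g, u, h)`. -/
def arrowG [IsRegularSemigroup S] {e f : E S} {u : S} (hu : InESF e u f) :
    LArrow (LG.mk' (gOf hu)).cls (LG.mk' (hOf hu)).cls where
  src := gOf hu
  val := u
  tgt := hOf hu
  src_eq := rfl
  tgt_eq := rfl
  mem := Or.inr <| Or.inr
    ⟨⟨u, invBelow hu, (invBelow_spec hu).1, (invBelow_spec hu).2.1, rfl, rfl⟩, rfl⟩

/-- The inclusion `r(h, h, f)`. -/
def arrowP [IsRegularSemigroup S] {b : LG S} {e f : E S} {u : S} (hf : LG.mk' f = b)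
    (hu : InESF e u f) : LArrow (LG.mk' (hOf hu)).cls b.cls where
  src := hOf hu
  val := (hOf hu).1
  tgt := f
  src_eq := rfl
  tgt_eq := congrArg LG.cls hf
  mem := Or.inl ⟨by
    change invBelow hu * u * f.1 = invBelow hu * u
    rw [mul_assoc, hu.right], rfl⟩

/-- The morphism `r(e, u, f) = r(e, g, g) r(g, u, h) r(h, h, f)` of `ℒ_G`, for `u ∈ e S f`, from
the class `a` of `e` to the class `b` of `f`. -/
def LG.r [IsRegularSemigroup S] {a b : LG S} (e : E S) (u : S) (f : E S) (he : LG.mk' e = a)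
    (hf : LG.mk' f = b) (hu : InESF e u f) : a ⟶ b :=
  LG.ofArrow (arrowQ he hu) ≫ LG.ofArrow (arrowG hu) ≫ LG.ofArrow (arrowP hf hu)

theorem LG.val_r [IsRegularSemigroup S] {a b : LG S} (e : E S) (u : S) (f : E S) (he : LG.mk' e = a)
    (hf : LG.mk' f = b) (hu : InESF e u f) (g : E S) (hg : LG.mk' g = a) :
    LG.val g hg (LG.r e u f he hf hu) = g.1 * u := by
  obtain ⟨h1, h2, h3⟩ := invBelow_spec hu
  rw [LG.r, LG.val_comp g (gOf hu) hg rfl, LG.val_comp (gOf hu) (hOf hu) rfl rfl,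
    LG.val_ofArrow, LG.val_ofArrow, LG.val_ofArrow]
  change g.1 * (u * invBelow hu) * (u * invBelow hu * u * (invBelow hu * u * (invBelow hu * u)))
    = g.1 * u
  rw [h1, ← mul_assoc (invBelow hu * u), h2, ← mul_assoc u, h1, mul_assoc, h1]

theorem LG.isIncl_iff {a b : LG S} (m : a ⟶ b) :
    IsIncl m ↔ ∀ e he, LG.val e he m = e.1 := by
  constructor
  · rintro ⟨r, ⟨_, h2⟩, rfl⟩ e he
    rw [LG.val_ofArrow, h2]
    exact (LQ.mk_eq.1 ((congrArg LG.cls he).trans r.src_eq.symm)).1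
  · intro h
    obtain ⟨e, he⟩ := LG.exists_rep a
    obtain ⟨f, hf⟩ := LG.exists_rep b
    have hp : InPL e e.1 f := ⟨by
      have := LG.val_mul e f he hf m
      rwa [h e he] at this, rfl⟩
    refine ⟨⟨e, e.1, f, congrArg LG.cls he, congrArg LG.cls hf, Or.inl hp⟩, hp, ?_⟩
    apply LG.hom_ext e he
    rw [h e he, LG.val_ofArrow]
    exact e.2.symm

instance : IsCatWithSubobjects (LG S) where
  id_mem c := (LG.isIncl_iff _).2 fun e he => LG.val_id e he
  comp_mem {a b c} m n hm hn := (LG.isIncl_iff _).2 fun e he => by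
    obtain ⟨f, hf⟩ := LG.exists_rep b
    rw [LG.val_comp e f he hf, (LG.isIncl_iff n).1 hn, LG.val_mul e f he hf,
      (LG.isIncl_iff m).1 hm]
  unique {a b} m n hm hn := by
    obtain ⟨e, he⟩ := LG.exists_rep a
    exact LG.hom_ext e he (by rw [(LG.isIncl_iff m).1 hm, (LG.isIncl_iff n).1 hn])
  strict {a b} m n hm hn := by
    obtain ⟨e, rfl⟩ := LG.exists_rep a
    obtain ⟨f, rfl⟩ := LG.exists_rep b
    have h1 := LG.val_mul e f rfl rfl m
    have h2 := LG.val_mul f e rfl rfl n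
    rw [(LG.isIncl_iff m).1 hm] at h1
    rw [(LG.isIncl_iff n).1 hn] at h2
    exact LG.mk'_eq.2 ⟨h1, h2⟩
  mono {a b} m hm := ⟨fun {c} h k hk => by
    obtain ⟨g, hg⟩ := LG.exists_rep c
    obtain ⟨e, he⟩ := LG.exists_rep a
    apply LG.hom_ext g hg
    have := congrArg (LG.val g hg) hk
    rwa [LG.val_comp g e hg he, LG.val_comp g e hg he, (LG.isIncl_iff m).1 hm,
      LG.val_mul g e hg he, LG.val_mul g e hg he] at this⟩
  of_comp {a b c} h g hhg hg := (LG.isIncl_iff _).2 fun e he => by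
    obtain ⟨f, hf⟩ := LG.exists_rep b
    have := (LG.isIncl_iff _).1 hhg e he
    rwa [LG.val_comp e f he hf, (LG.isIncl_iff g).1 hg, LG.val_mul e f he hf] at this

theorem inESF_mul_right (g e : E S) : InESF g (g.1 * e.1) e :=
  InESF.of (by rw [← mul_assoc, g.2]) (by rw [mul_assoc, e.2])

/-- A representative of an object of `ℒ_G`. -/
def LG.rep (c : LG S) : E S := (LG.exists_rep c).choose

theorem LG.rep_spec (c : LG S) : LG.mk' c.rep = c := (LG.exists_rep c).choose_spec

variable [IsRegularSemigroup S]

theorem LG.val_rCone (e : E S) (c : LG S) (g : E S) (hg : LG.mk' g = c) :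
    LG.val g hg (LG.r c.rep (c.rep.1 * e.1) e c.rep_spec rfl (inESF_mul_right c.rep e)) =
      g.1 * e.1 := by
  rw [LG.val_r, ← mul_assoc, (LG.mk'_eq.1 (hg.trans c.rep_spec.symm)).1]

/-- The principal cone `r^e`, with apex the class of `e` and components `r(g, g e, e)`; they do not
depend on the representative `g`, see `rCone_app`. -/
abbrev rCone (e : E S) : NormalCone (LG S) where
  apex := LG.mk' e
  app c := LG.r c.rep (c.rep.1 * e.1) e c.rep_spec rfl (inESF_mul_right c.rep e)
  incl_comp {c c'} j hj := by
    obtain ⟨g, hg⟩ := LG.exists_rep c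
    obtain ⟨g', hg'⟩ := LG.exists_rep c'
    apply LG.hom_ext g hg
    rw [LG.val_comp g g' hg hg', LG.val_rCone, LG.val_rCone, ← mul_assoc,
      LG.val_mul g g' hg hg', (LG.isIncl_iff j).1 hj]
  exists_iso := by
    refine ⟨LG.mk' e, ?_⟩
    have : LG.r (LG.mk' e).rep ((LG.mk' e).rep.1 * e.1) e (LG.mk' e).rep_spec rfl
        (inESF_mul_right _ e) = 𝟙 (LG.mk' e) := by
      apply LG.hom_ext e rfl
      rw [LG.val_rCone, LG.val_id]
      exact e.2
    rw [this]
    infer_instance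

theorem rCone_app (e g : E S) :
    (rCone e).app (LG.mk' g) = LG.r g (g.1 * e.1) e rfl rfl (inESF_mul_right g e) := by
  apply LG.hom_ext g rfl
  refine (LG.val_rCone e _ g rfl).trans ((LG.val_r _ _ _ _ _ _ _ _).trans ?_).symm
  rw [← mul_assoc, g.2]

instance : IsNormalCategory (LG S) where
  factorization {a b} m := by
    obtain ⟨e, he⟩ := LG.exists_rep a
    obtain ⟨f, hf⟩ := LG.exists_rep b
    have hu : InESF e (LG.val e he m) f := InESF.of (LG.mul_val e he m) (LG.val_mul e f he hf m)
    obtain ⟨h1, h2, h3⟩ := invBelow_spec hu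
    have hgu : InESF (hOf hu) (invBelow hu) (gOf hu) :=
      InESF.of h2 (by change invBelow hu * (_ * invBelow hu) = _; rw [← mul_assoc, h2])
    have hge : InESF (gOf hu) (gOf hu).1 e :=
      InESF.of (gOf hu).2 (by change _ * invBelow hu * e.1 = _ * invBelow hu; rw [mul_assoc, h3])
    refine ⟨⟨_, _, LG.ofArrow (arrowQ he hu), LG.ofArrow (arrowG hu),
      LG.ofArrow (arrowP hf hu), ?_, ?_, ?_, ?_⟩⟩
    · refine ⟨LG.r (gOf hu) (gOf hu).1 e rfl he hge, (LG.isIncl_iff _).2 fun g hg => ?_, ?_⟩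
      · rw [LG.val_r]
        exact (LG.mk'_eq.1 hg).1
      · apply LG.hom_ext (gOf hu) rfl
        rw [LG.val_comp (gOf hu) e rfl he, LG.val_r, LG.val_ofArrow, LG.val_id, (gOf hu).2,
          ← mul_assoc, hge.right]
        exact (gOf hu).2
    · refine ⟨⟨LG.r (hOf hu) (invBelow hu) (gOf hu) rfl rfl hgu, ?_, ?_⟩⟩
      · apply LG.hom_ext (gOf hu) rfl
        rw [LG.val_comp (gOf hu) (hOf hu) rfl rfl, LG.val_r, LG.val_ofArrow, LG.val_id, hgu.left]
        exact congrArg (· * invBelow hu) h1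
      · apply LG.hom_ext (hOf hu) rfl
        rw [LG.val_comp (hOf hu) (gOf hu) rfl rfl, LG.val_r, LG.val_ofArrow, LG.val_id, hgu.left]
        exact congrArg (invBelow hu * ·) h1
    · exact ⟨_, (arrowP hf hu).mem.elim id (fun _ => ⟨by
        change invBelow hu * _ * f.1 = invBelow hu * _
        rw [mul_assoc, hu.right], rfl⟩), rfl⟩
    · apply LG.hom_ext e he
      have := LG.val_r e _ f he hf hu e he
      rw [LG.r] at this
      rw [this, LG.mul_val]
  splits {a b} j hj := by
    obtain ⟨e, he⟩ := LG.exists_rep a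
    obtain ⟨f, hf⟩ := LG.exists_rep b
    refine ⟨LG.r f (f.1 * e.1) e hf he (inESF_mul_right f e), LG.hom_ext e he ?_⟩
    have h1 := LG.val_mul e f he hf j
    rw [(LG.isIncl_iff j).1 hj] at h1
    rw [LG.val_comp e f he hf, LG.val_r, (LG.isIncl_iff j).1 hj, LG.val_id, ← mul_assoc f.1,
      f.2, ← mul_assoc, h1]
    exact e.2
  cone c := by
    obtain ⟨e, rfl⟩ := LG.exists_rep c
    exact ⟨rCone e, rfl, LG.hom_ext e rfl ((LG.val_rCone e _ e rfl).trans e.2)⟩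

end LG

/-! ### The category `ℛ_G` and the functor `Γ_G` -/

section RG

variable (S : Type u) [Semigroup S]

/-- The category `ℛ_G` is built dually, that is, it is the category `ℒ_G` of the opposite
semigroup: there `ω^l`, `ℒ`, `e S f`, a product `u v` and a morphism `(x, x')` become `ω^r`,
`ℛ`, `f S e`, the product `v u` and the morphism `(x', x)` of `S`. -/
abbrev RG : Type u := LG Sᵐᵒᵖ

variable {S}

/-- An idempotent of `S` as an idempotent of the opposite semigroup. -/
def opE (e : E S) : E Sᵐᵒᵖ := ⟨MulOpposite.op e.1, by
  change MulOpposite.op e.1 * MulOpposite.op e.1 = MulOpposite.op e.1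
  rw [← MulOpposite.op_mul, e.2]⟩

/-- The object of `ℛ_G` given by the `ℛ`-class of `e`. -/
abbrev RG.mk' (e : E S) : RG S := LG.mk' (opE e)

theorem InESF.op {e f : E S} {u : S} (hu : InESF f u e) :
    InESF (opE e) (MulOpposite.op u) (opE f) := by
  obtain ⟨s, rfl⟩ := hu
  exact ⟨MulOpposite.op s, by simp [opE, mul_assoc]⟩

variable [IsRegularSemigroup S]

/-- The morphism `l(e, u, f)` of `ℛ_G`, for `u ∈ f S e`, from the class of `e` to that of `f`. -/
def RG.l (e : E S) (u : S) (f : E S) (hu : InESF f u e) : RG.mk' e ⟶ RG.mk' f :=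
  LG.r (opE e) (MulOpposite.op u) (opE f) rfl rfl hu.op

/-- The natural transformation `η_{r^e} ℒ_G(r(f, u, e), -) η_{r^f}⁻¹` from `H(r^e; -)` to
`H(r^f; -)`, for `u ∈ f S e`. -/
def transported (e : E S) (u : S) (f : E S) (hu : InESF f u e) :
    (rCone e).HObj ⟶ (rCone f).HObj :=
  NormalDual.Hom.mk ((rCone e).η.hom ≫
    coyoneda.map (Quiver.Hom.op (LG.r (a := (rCone f).apex) (b := (rCone e).apex)
      f u e rfl rfl hu)) ≫ (rCone f).η.inv)

/-- The defining equations of the functor `Γ_G`. -/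
structure IsGammaG (Γ : RG S ⥤ NormalDual (LG S)) : Prop where
  obj_eq : ∀ e : E S, Γ.obj (RG.mk' e) = (rCone e).HObj
  map_eq : ∀ (e : E S) (u : S) (f : E S) (hu : InESF f u e),
    Γ.map (RG.l e u f hu) =
      eqToHom (obj_eq e) ≫ transported e u f hu ≫ eqToHom (obj_eq f).symm

end RG

end CrossConn

end

noncomputable section

namespace CrossConn

-- The apex of `γ.star p` must unfold to the codomain of `p`, so that morphisms out of that codomain
-- can serve as morphisms out of the apex.
attribute [reducible] NormalCone.star NormalCone.H

/-! ### Calculus of the cones `γ * p` -/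

section Dual

variable {C : Type u} [SmallCategory C] [HasInclusions C] [IsNormalCategory C]

/-! By Yoneda, a morphism `H(γ; -) ⟶ H(δ; -)` is the same as a morphism `c_δ ⟶ c_γ`, with
composition reversed (`dualMap_comp`, `dualMap_injective`, `dualMap_surjective`). Under this
dictionary the inclusions are exactly the epimorphisms `f` with `γ = δ * f` (`isIncl_dualMap_iff`).
So the factorizations and splittings required of `N*C` are those of `C` read backwards. For the
cones of `N*C`, each H-functor is written as `H(ε; -)` with `ε` the identity at its own apex. The
rule `δ ↦ ε * δ(c_ε)°` mentions only the cone `δ`, not the functor in which it lies, hence is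
compatible with inclusions.

For a regular semigroup, a morphism in `ℒ_G` between the classes of `f` and `e` is an element of `f
S e`, and so is a morphism in `ℛ_G` from the class of `e` to that of `f`. Yoneda therefore makes
`Γ_G` fully faithful. If `e ω^r f`, then `r(f, e, e)` is a split epimorphism with `r^f * r(f, e, e)
= r^e`, so inclusions go to inclusions (`isIncl_transported`). Strictness of inclusions then shows
that `H(r^e; -)` depends only on the `ℛ`-class of `e`.

The ideals carry the rest. A subobject of `H(r^f; -)` is given by an epimorphism `u ∈ f S h` with a
section `v`, so `v u = h`. Then `e = u v` is an idempotent with `e ω^r f`, and `u` is an isomorphism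
carrying `r^e` to the given cone (`exists_omegaR_of_isIncl`). Conversely, below `f` the functor
`H(r^e; -)` determines the `ℛ`-class of `e` (`omegaR_of_isIncl`). Finally `r^e` is the identity at
the class of `e`, which gives the condition on `M`-sets. -/

theorem exists_section_of_epi {c d : C} (p : c ⟶ d) [Epi p] : ∃ s : d ⟶ c, s ≫ p = 𝟙 d := by
  obtain ⟨r, hr⟩ := IsNormalCategory.splits _ (imIncl_incl p)
  obtain ⟨s, hs⟩ := epiPart_split p
  have : Epi (epiPart p ≫ imIncl p) := by rw [epiPart_comp]; infer_instance
  have : Epi (imIncl p) := epi_of_epi (epiPart p) (imIncl p)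
  have h1 : r ≫ imIncl p = 𝟙 d := by
    rw [← cancel_epi (imIncl p), reassoc_of% hr, Category.comp_id]
  refine ⟨r ≫ s, ?_⟩
  calc (r ≫ s) ≫ p = r ≫ (s ≫ epiPart p) ≫ imIncl p := by
        rw [Category.assoc, Category.assoc, epiPart_comp]
    _ = 𝟙 d := by rw [hs, Category.id_comp, h1]

theorem NormalCone.star_congr (γ : NormalCone C) {a b : C} (p : γ.apex ⟶ a) (p' : γ.apex ⟶ b)
    [Epi p] [Epi p'] (h : a = b) (e : p ≫ eqToHom h = p') : γ.star p = γ.star p' := by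
  subst h
  obtain rfl : p = p' := by simpa using e
  rfl

theorem NormalCone.star_star (γ : NormalCone C) {a b : C} (p : γ.apex ⟶ a) (q : a ⟶ b)
    [Epi p] [Epi q] :
    NormalCone.star (γ.star p) (d := b) q = γ.star (p ≫ q) := by
  ext
  · rfl
  · exact heq_of_eq (funext fun c => Category.assoc _ _ _)

theorem NormalCone.star_id (γ : NormalCone C) : γ.star (𝟙 γ.apex) = γ := by
  ext
  · rfl
  · exact heq_of_eq (funext fun c => Category.comp_id _)

/-- `γ * (p j)° = γ * p` for an epimorphism `p` and an inclusion `j`. -/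
theorem NormalCone.starEpi_comp_incl (γ : NormalCone C) {a d : C} (p : γ.apex ⟶ a) [Epi p]
    (j : a ⟶ d) (hj : IsIncl j) : γ.starEpi d (p ≫ j) = γ.star p := by
  obtain ⟨h, h1, -⟩ := factor_unique (epiPart (p ≫ j)) (imIncl (p ≫ j)) p j
    (epiPart_split _) (exists_section_of_epi p) (imIncl_incl _) hj (epiPart_comp _)
  exact γ.star_congr _ _ h h1

theorem NormalCone.starEpi_epi (γ : NormalCone C) {a : C} (p : γ.apex ⟶ a) [Epi p] :
    γ.starEpi a p = γ.star p := by
  simpa using γ.starEpi_comp_incl p (𝟙 a) (IsCatWithSubobjects.id_mem a)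

theorem NormalCone.starEpi_id (γ : NormalCone C) : γ.starEpi γ.apex (𝟙 γ.apex) = γ := by
  rw [starEpi_epi, star_id]

/-- `γ * (f j)° = γ * f°` for an inclusion `j`. -/
theorem NormalCone.starEpi_incl (γ : NormalCone C) {a d : C} (f : γ.apex ⟶ a)
    (j : a ⟶ d) (hj : IsIncl j) : γ.starEpi d (f ≫ j) = γ.starEpi a f := by
  have := γ.starEpi_comp_incl (epiPart f) (imIncl f ≫ j)
    (IsCatWithSubobjects.comp_mem _ _ (imIncl_incl f) hj)
  rwa [← Category.assoc, epiPart_comp] at this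

/-- `(γ * p) * k° = γ * (p k)°`. -/
theorem NormalCone.star_starEpi (γ : NormalCone C) {a c : C} (p : γ.apex ⟶ a) [Epi p]
    (k : a ⟶ c) : NormalCone.starEpi (γ.star p) c k = γ.starEpi c (p ≫ k) := by
  have h : γ.starEpi c ((p ≫ epiPart k) ≫ imIncl k) = γ.star (p ≫ epiPart k) :=
    γ.starEpi_comp_incl _ _ (imIncl_incl k)
  rw [Category.assoc, epiPart_comp] at h
  rw [h, starEpi, star_star]

/-! ### Subobjects in the normal dual -/

theorem NormalDual.hom_ext {F G : NormalDual C} {σ τ : F ⟶ G}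
    (h : ∀ c x, NormalDual.comp σ c x = NormalDual.comp τ c x) : σ = τ := by
  refine NormalDual.Hom.ext ?_
  ext c x
  exact h c x

theorem NormalDual.comp_id (F : NormalDual C) (c : C) (x : F.fn.obj c) :
    NormalDual.comp (𝟙 F) c x = x := rfl

theorem NormalDual.comp_comp {F G K : NormalDual C} (σ : F ⟶ G) (τ : G ⟶ K) (c : C)
    (x : F.fn.obj c) :
    NormalDual.comp (σ ≫ τ) c x = NormalDual.comp τ c (NormalDual.comp σ c x) := rfl

theorem NormalDual.comp_map {F G : NormalDual C} (σ : F ⟶ G) {c d : C} (g : c ⟶ d)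
    (x : F.fn.obj c) :
    NormalDual.comp σ d (F.fn.map g x) = G.fn.map g (NormalDual.comp σ c x) :=
  ConcreteCategory.congr_hom (σ.nat.naturality g) x

theorem NormalDual.isIncl_iff {F G : NormalDual C} (σ : F ⟶ G) :
    IsIncl σ ↔ ∀ c x, (NormalDual.comp σ c x).1 = x.1 := Iff.rfl

instance : IsCatWithSubobjects (NormalDual C) where
  id_mem F := fun c x => rfl
  comp_mem σ τ hσ hτ := fun c x => (hτ c _).trans (hσ c x)
  unique σ τ hσ hτ := NormalDual.hom_ext fun c x => Subtype.ext ((hσ c x).trans (hτ c x).symm)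
  strict {F G} σ τ hσ hτ := by
    have hobj : F.fn.obj = G.fn.obj := by
      funext c
      ext x
      constructor
      · intro hx
        exact (hσ c ⟨x, hx⟩).subst (motive := (· ∈ G.fn.obj c)) (NormalDual.comp σ c ⟨x, hx⟩).2
      · intro hx
        exact (hτ c ⟨x, hx⟩).subst (motive := (· ∈ F.fn.obj c)) (NormalDual.comp τ c ⟨x, hx⟩).2
    -- Naturality of an inclusion forces the two functors to act alike on the cones that they share.
    have hmap : ∀ {c d : C} (g : c ⟶ d) (x : F.fn.obj c) (y : G.fn.obj c), x.1 = y.1 →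
        (F.fn.map g x).1 = (G.fn.map g y).1 := by
      intro c d g x y h
      have : NormalDual.comp σ c x = y := Subtype.ext ((hσ c x).trans h)
      rw [← this, ← NormalDual.comp_map, hσ]
    obtain ⟨⟨Fo, Fm, _, _⟩, _⟩ := F
    obtain ⟨⟨Go, Gm, _, _⟩, _⟩ := G
    obtain rfl : Fo = Go := hobj
    obtain rfl : @Fm = @Gm := by
      funext c d g x
      exact Subtype.ext (hmap g x x rfl)
    rfl
  mono σ hσ := ⟨fun h k e => NormalDual.hom_ext fun c x => Subtype.ext <| by
    have := congrArg (fun t => (NormalDual.comp t c x).1) e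
    simpa only [NormalDual.comp_comp, (NormalDual.isIncl_iff σ).1 hσ] using this⟩
  of_comp h g hhg hg := fun c x => (hg c _).symm.trans (hhg c x)

/-! ### Yoneda: morphisms and inclusions of H-functors -/

/-- The morphism `η_γ C(f, -) η_δ⁻¹` from `H(γ; -)` to `H(δ; -)` given by `f : c_δ ⟶ c_γ`. -/
def dualMap (γ δ : NormalCone C) (f : δ.apex ⟶ γ.apex) : γ.HObj ⟶ δ.HObj :=
  NormalDual.Hom.mk (γ.η.hom ≫ coyoneda.map f.op ≫ δ.η.inv)

theorem comp_dualMap (γ δ : NormalCone C) (f : δ.apex ⟶ γ.apex) (c : C) (k : γ.apex ⟶ c) :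
    NormalDual.comp (dualMap γ δ f) c (γ.starEquiv c k) = δ.starEquiv c (f ≫ k) := by
  change δ.starEquiv c (f ≫ (γ.starEquiv c).symm (γ.starEquiv c k)) = _
  rw [Equiv.symm_apply_apply]

theorem NormalCone.exists_starEquiv (γ : NormalCone C) {c : C} (x : γ.HObj.fn.obj c) :
    ∃ k, x = γ.starEquiv c k := ⟨_, ((γ.starEquiv c).apply_symm_apply x).symm⟩

theorem dualMap_id (γ : NormalCone C) : dualMap γ γ (𝟙 γ.apex) = 𝟙 γ.HObj :=
  NormalDual.hom_ext fun c x => by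
    obtain ⟨k, rfl⟩ := γ.exists_starEquiv x
    rw [comp_dualMap, NormalDual.comp_id, Category.id_comp]

theorem dualMap_comp (γ δ ε : NormalCone C) (f : δ.apex ⟶ γ.apex) (g : ε.apex ⟶ δ.apex) :
    dualMap γ δ f ≫ dualMap δ ε g = dualMap γ ε (g ≫ f) :=
  NormalDual.hom_ext fun c x => by
    obtain ⟨k, rfl⟩ := γ.exists_starEquiv x
    rw [NormalDual.comp_comp, comp_dualMap, comp_dualMap, comp_dualMap, Category.assoc]

theorem dualMap_injective (γ δ : NormalCone C) : Function.Injective (dualMap γ δ) := by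
  intro f g h
  have := congrArg (fun t => NormalDual.comp t _ (γ.starEquiv _ (𝟙 γ.apex))) h
  simp only [comp_dualMap, Category.comp_id] at this
  exact (δ.starEquiv _).injective this

/-- Yoneda: by naturality a morphism is determined by its value at the generic element `γ = γ * 1°`
of `H(γ; c_γ)`. -/
theorem dualMap_surjective (γ δ : NormalCone C) : Function.Surjective (dualMap γ δ) := by
  intro σ
  refine ⟨(δ.starEquiv _).symm (NormalDual.comp σ _ (γ.starEquiv _ (𝟙 γ.apex))),
    NormalDual.hom_ext fun c x => ?_⟩
  obtain ⟨k, rfl⟩ := γ.exists_starEquiv x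
  have h : γ.starEquiv c k = γ.HObj.fn.map k (γ.starEquiv _ (𝟙 γ.apex)) := by
    change _ = γ.starEquiv c ((γ.starEquiv _).symm (γ.starEquiv _ (𝟙 γ.apex)) ≫ k)
    rw [Equiv.symm_apply_apply, Category.id_comp]
  rw [comp_dualMap, h, NormalDual.comp_map]

/-- `H(γ; -) ⊆ H(δ; -)` along `f` if and only if `f` is an epimorphism with `γ = δ * f`. -/
theorem isIncl_dualMap_iff {γ δ : NormalCone C} {f : δ.apex ⟶ γ.apex} :
    IsIncl (dualMap γ δ f) ↔ Epi f ∧ ∀ a, δ.app a ≫ f = γ.app a := by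
  constructor
  · intro h
    -- Generalizing the image of `f` to `x` lets `γ` be replaced by `δ * p`; the inclusion `j` then
    -- runs from an object to itself, so it is the identity.
    have key : ∀ (x : C) (p : δ.apex ⟶ x) [Epi p] (j : x ⟶ γ.apex), IsIncl j →
        δ.star p = γ → Epi (p ≫ j) ∧ ∀ a, δ.app a ≫ p ≫ j = γ.app a := by
      rintro x p _ j hj rfl
      obtain rfl : j = 𝟙 x := IsCatWithSubobjects.unique _ _ hj (IsCatWithSubobjects.id_mem x)
      simpa using inferInstanceAs (Epi p)
    -- Evaluated at the generic element, the inclusion says `δ * f° = γ`.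
    have h1 := h _ (γ.starEquiv _ (𝟙 γ.apex))
    rw [comp_dualMap, Category.comp_id] at h1
    have := key _ (epiPart f) (imIncl f) (imIncl_incl f) (h1.trans γ.starEpi_id)
    rwa [epiPart_comp] at this
  · rintro ⟨_, h⟩ c x
    obtain ⟨k, rfl⟩ := γ.exists_starEquiv x
    rw [comp_dualMap]
    refine (δ.star_starEpi f k).symm.trans ?_
    ext
    · rfl
    · exact heq_of_eq (funext fun a => congrArg (· ≫ epiPart k) (h a))

/-- The inclusion of `H(δ * p; -)` in `H(δ; -)`. -/
theorem isIncl_dualMap_star (δ : NormalCone C) {a : C} (p : δ.apex ⟶ a) [Epi p] :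
    IsIncl (dualMap (δ.star p) δ p) :=
  isIncl_dualMap_iff.2 ⟨inferInstanceAs (Epi p), fun _ => rfl⟩

/-- Since `(γ * p) * p⁻¹ = γ`, each of the two functors is included in the other. -/
theorem NormalCone.HObj_star_of_isIso (γ : NormalCone C) {a : C} (p : γ.apex ⟶ a) [IsIso p] :
    (γ.star p).HObj = γ.HObj := by
  have h : NormalCone.star (γ.star p) (inv p) = γ := by
    rw [star_star]
    conv_rhs => rw [← γ.star_id]
    exact γ.star_congr _ _ rfl (by simp)
  have h1 : Sub (NormalCone.star (γ.star p) (inv p)).HObj (γ.star p).HObj :=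
    ⟨_, isIncl_dualMap_star (γ.star p) (inv p)⟩
  rw [h] at h1
  obtain ⟨τ, hτ⟩ := h1
  exact IsCatWithSubobjects.strict _ _ (isIncl_dualMap_star γ p) hτ

/-- Every object of the normal dual is `H(ε; -)` for an idempotent cone `ε`. -/
theorem NormalDual.exists_idempotent (F : NormalDual C) :
    ∃ ε : NormalCone C, ε.app ε.apex = 𝟙 ε.apex ∧ F = ε.HObj := by
  obtain ⟨_, γ, rfl⟩ := F
  obtain ⟨c, hc⟩ := γ.exists_iso
  refine ⟨γ.star (inv (γ.app c)), IsIso.hom_inv_id (γ.app c), ?_⟩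
  exact (γ.HObj_star_of_isIso _).symm

/-- The morphism to `H(ε; -)` with components `δ ↦ ε * δ(c_ε)°`. -/
theorem exists_hom_to_HObj (ε : NormalCone C) (F : NormalDual C) :
    ∃ σ : F ⟶ ε.HObj, ∀ c x, (NormalDual.comp σ c x).1 = ε.starEpi _ (x.1.app ε.apex) := by
  obtain ⟨_, γ, rfl⟩ := F
  -- If `x = γ * k°`, its image is `ε * (γ(c_ε) k)°`. Dropping the inclusion part of `k` does not
  -- change this cone, and `γ(c_ε) k°` is `x(c_ε)`.
  refine ⟨dualMap γ ε (γ.app ε.apex), fun c x => ?_⟩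
  obtain ⟨k, rfl⟩ := γ.exists_starEquiv x
  rw [comp_dualMap]
  have := ε.starEpi_incl (γ.app ε.apex ≫ epiPart k) (imIncl k) (imIncl_incl k)
  rwa [Category.assoc, epiPart_comp] at this

/-! ### Normality of the normal dual -/

instance : IsNormalCategory (NormalDual C) where
  factorization {F G} σ := by
    obtain ⟨_, γ, rfl⟩ := F
    obtain ⟨_, δ, rfl⟩ := G
    obtain ⟨f, rfl⟩ := dualMap_surjective γ δ σ
    obtain ⟨q, hq⟩ := IsNormalCategory.splits _ (imIncl_incl f)
    have : IsSplitEpi q := ⟨⟨⟨_, hq⟩⟩⟩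
    -- Write `f = f° j` with `j q = 1`. The dual of `j` is a retraction, split by the inclusion dual
    -- to `q`, and the dual of `f°` is an inclusion. The middle cones `γ * q` and `δ * f°` share the
    -- apex `im f`, whose identity supplies the isomorphism.
    refine ⟨⟨(γ.star q).HObj, (δ.star (epiPart f)).HObj, dualMap γ (γ.star q) (imIncl f),
      dualMap (γ.star q) (δ.star (epiPart f)) (𝟙 (im f)),
      dualMap (δ.star (epiPart f)) δ (epiPart f), ?_, ?_, ?_, ?_⟩⟩
    · refine ⟨dualMap (γ.star q) γ q, isIncl_dualMap_star γ q, ?_⟩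
      rw [dualMap_comp, hq]
      exact dualMap_id (γ.star q)
    · refine ⟨⟨dualMap (δ.star (epiPart f)) (γ.star q) (𝟙 (im f)), ?_, ?_⟩⟩
      · rw [dualMap_comp, ← dualMap_id]
        exact congrArg _ (Category.comp_id _)
      · rw [dualMap_comp, ← dualMap_id]
        exact congrArg _ (Category.comp_id _)
    · exact isIncl_dualMap_star δ _
    · rw [dualMap_comp, dualMap_comp]
      congr 1
      refine Eq.trans ?_ (epiPart_comp f)
      exact congrArg (· ≫ imIncl f) (Category.comp_id (epiPart f))
  splits {F G} σ hσ := by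
    obtain ⟨_, γ, rfl⟩ := F
    obtain ⟨_, δ, rfl⟩ := G
    obtain ⟨f, rfl⟩ := dualMap_surjective γ δ σ
    obtain ⟨_, -⟩ := isIncl_dualMap_iff.1 hσ
    obtain ⟨s, hs⟩ := exists_section_of_epi f
    exact ⟨dualMap δ γ s, by rw [dualMap_comp, hs, dualMap_id]⟩
  cone F := by
    obtain ⟨ε, hε, rfl⟩ := F.exists_idempotent
    choose σ hσ using exists_hom_to_HObj ε
    -- At `x = ε * k°` the value is `ε * (ε(c_ε) k°)°`, which is `x` again because `ε(c_ε) = 1`.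
    have hid : σ ε.HObj = 𝟙 _ := NormalDual.hom_ext fun c x => Subtype.ext <| by
      rw [hσ, NormalDual.comp_id]
      obtain ⟨k, rfl⟩ := ε.exists_starEquiv x
      change ε.starEpi _ (ε.app ε.apex ≫ epiPart k) = ε.starEpi c k
      rw [hε, Category.id_comp, NormalCone.starEpi_epi]
      rfl
    refine ⟨⟨ε.HObj, σ, fun {F G} j hj => NormalDual.hom_ext fun c x => Subtype.ext ?_,
      ε.HObj, by rw [hid]; infer_instance⟩, rfl, hid.trans (eqToHom_refl _ _).symm⟩
    -- The formula for `σ` depends only on the underlying cone, which `j` leaves unchanged.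
    rw [NormalDual.comp_comp, hσ, hσ, hj]

end Dual

/-! ### Morphisms of `ℒ_G` and `ℛ_G` as elements of `S` -/

section Gamma

variable {S : Type u} [Semigroup S]

/-- Together with uniqueness of inclusions, this identifies transports along equalities of objects
with explicit inclusions. -/
theorem eqToHom_isIncl {C : Type u} [SmallCategory C] [HasInclusions C] [IsCatWithSubobjects C]
    {a b : C} (h : a = b) : IsIncl (eqToHom h) := by
  subst h
  exact IsCatWithSubobjects.id_mem a

theorem exists_opE (e : E Sᵐᵒᵖ) : ∃ f : E S, opE f = e :=
  ⟨⟨e.1.unop, congrArg MulOpposite.unop e.2⟩, rfl⟩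

theorem RG.exists_rep (a : RG S) : ∃ e : E S, RG.mk' e = a := by
  obtain ⟨e, rfl⟩ := LG.exists_rep a
  obtain ⟨f, rfl⟩ := exists_opE e
  exact ⟨f, rfl⟩

theorem RG.mk'_eq {e f : E S} : RG.mk' e = RG.mk' f ↔ omegaR e f ∧ omegaR f e :=
  LG.mk'_eq.trans (and_congr MulOpposite.op_injective.eq_iff MulOpposite.op_injective.eq_iff)

theorem LG.inESF_val {a b : LG S} (e f : E S) (he : LG.mk' e = a) (hf : LG.mk' f = b)
    (m : a ⟶ b) : InESF e (LG.val e he m) f :=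
  InESF.of (LG.mul_val e he m) (LG.val_mul e f he hf m)

theorem InESF.mul {e f g : E S} {u v : S} (hu : InESF e u f) (hv : InESF f v g) :
    InESF e (u * v) g :=
  InESF.of (by rw [← mul_assoc, hu.left]) (by rw [mul_assoc, hv.right])

theorem inESF_of_omegaR {e f : E S} (h : omegaR e f) : InESF f e.1 e := InESF.of h e.2

/-- A representative in `E(S)` of an object of `ℛ_G`. -/
def RG.rep (a : RG S) : E S := (RG.exists_rep a).choose

theorem RG.rep_spec (a : RG S) : RG.mk' a.rep = a := (RG.exists_rep a).choose_spec

theorem RG.inESF_val {a b : RG S} (e f : E S) (he : RG.mk' e = a) (hf : RG.mk' f = b)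
    (m : a ⟶ b) : InESF f (LG.val (opE e) he m).unop e :=
  InESF.of (congrArg MulOpposite.unop (LG.val_mul (opE e) (opE f) he hf m))
    (congrArg MulOpposite.unop (LG.mul_val (opE e) he m))

variable [IsRegularSemigroup S]

theorem LG.val_r_self {a b : LG S} (e : E S) (u : S) (f : E S) (he : LG.mk' e = a)
    (hf : LG.mk' f = b) (hu : InESF e u f) : LG.val e he (LG.r e u f he hf hu) = u := by
  rw [LG.val_r, hu.left]

theorem LG.r_val {a b : LG S} (e f : E S) (he : LG.mk' e = a) (hf : LG.mk' f = b) (m : a ⟶ b) :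
    LG.r e (LG.val e he m) f he hf (LG.inESF_val e f he hf m) = m :=
  LG.hom_ext e he (LG.val_r_self _ _ _ _ _ _)

theorem LG.r_comp {a b c : LG S} (e f g : E S) (u v : S) (he : LG.mk' e = a)
    (hf : LG.mk' f = b) (hg : LG.mk' g = c) (hu : InESF e u f) (hv : InESF f v g) :
    LG.r e u f he hf hu ≫ LG.r f v g hf hg hv = LG.r e (u * v) g he hg (hu.mul hv) := by
  apply LG.hom_ext e he
  rw [LG.val_comp e f he hf, LG.val_r_self, LG.val_r_self, LG.val_r_self]

theorem LG.r_id {a : LG S} (e : E S) (he : LG.mk' e = a) (h : InESF e e.1 e) :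
    LG.r e e.1 e he he h = 𝟙 a :=
  LG.hom_ext e he (by rw [LG.val_r_self, LG.val_id])

theorem LG.val_rCone_app (e : E S) (c : LG S) (g : E S) (hg : LG.mk' g = c) :
    LG.val g hg ((rCone e).app c) = g.1 * e.1 := LG.val_rCone e c g hg

/-! ### The functors `H(r^e; -)` and their subobjects -/

theorem transported_comp {e f g : E S} {u v : S} (hu : InESF f u e) (hv : InESF g v f) :
    transported e u f hu ≫ transported f v g hv = transported e (v * u) g (hv.mul hu) :=
  (dualMap_comp _ _ _ _ _).trans (congrArg _ (LG.r_comp _ _ _ _ _ _ _ _ _ _))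

theorem transported_congr {e f : E S} {u v : S} (hu : InESF f u e) (hv : InESF f v e)
    (h : u = v) : transported e u f hu = transported e v f hv := by
  subst h
  rfl

theorem transported_self {e : E S} (h : InESF e e.1 e) :
    transported e e.1 e h = 𝟙 (rCone e).HObj :=
  (congrArg _ (LG.r_id e rfl h)).trans (dualMap_id (rCone e))

theorem transported_injective {e f : E S} {u v : S} {hu : InESF f u e} {hv : InESF f v e}
    (h : transported e u f hu = transported e v f hv) : u = v := by
  have := congrArg (LG.val f rfl) (dualMap_injective (rCone e) (rCone f) h)
  rwa [LG.val_r_self, LG.val_r_self] at this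

theorem exists_transported {e f : E S} (σ : (rCone e).HObj ⟶ (rCone f).HObj) :
    ∃ u hu, σ = transported e u f hu := by
  obtain ⟨m, rfl⟩ := dualMap_surjective _ _ σ
  exact ⟨_, LG.inESF_val f e rfl rfl m, congrArg _ (LG.r_val f e rfl rfl m).symm⟩

/-- The inclusion `H(r^e; -) ⊆ H(r^f; -)` for `e ω^r f`. -/
theorem isIncl_transported {e f : E S} (h : omegaR e f) :
    IsIncl (transported e e.1 f (inESF_of_omegaR h)) := by
  refine isIncl_dualMap_iff.2 ⟨?_, fun a => ?_⟩
  · have : IsSplitEpi (LG.r (a := LG.mk' f) (b := LG.mk' e) f e.1 e rfl rfl (inESF_of_omegaR h)) :=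
      ⟨⟨⟨LG.r e (e.1 * f.1) f rfl rfl (inESF_mul_right e f), LG.hom_ext e rfl (by
        rw [LG.r_comp, LG.val_r_self, LG.val_id, mul_assoc, h, e.2])⟩⟩⟩
    infer_instance
  · obtain ⟨g, hg⟩ := LG.exists_rep a
    apply LG.hom_ext g hg
    rw [LG.val_comp g f hg rfl, LG.val_rCone_app, LG.val_rCone_app, LG.val_r_self, mul_assoc, h]

/-- For idempotents `e`, `e'` of `ω^r(f)`, `H(r^e; -) ⊆ H(r^e'; -)` implies `e ω^r e'`. -/
theorem omegaR_of_isIncl {e e' f : E S} (h : omegaR e f) (h' : omegaR e' f)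
    (σ : (rCone e).HObj ⟶ (rCone e').HObj) (hσ : IsIncl σ) : omegaR e e' := by
  obtain ⟨u, hu, rfl⟩ := exists_transported σ
  -- At the class of `f` the cones read `f e' u = f e`. Since `f` is a left identity for `e` and
  -- `e'`, this gives `u = e`. Without a common bound the conclusion can fail: in a left zero
  -- semigroup all the cones `r^e` coincide.
  have := congrArg (LG.val f rfl) ((isIncl_dualMap_iff.1 hσ).2 (LG.mk' f))
  rw [LG.val_comp f e' rfl rfl, LG.val_rCone_app, LG.val_rCone_app, LG.val_r_self, h, h',
    hu.left] at this
  rw [omegaR, ← this, hu.left]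

theorem HObj_rCone_eq {e f : E S} (h : RG.mk' e = RG.mk' f) : (rCone e).HObj = (rCone f).HObj :=
  IsCatWithSubobjects.strict _ _ (isIncl_transported (RG.mk'_eq.1 h).1)
    (isIncl_transported (RG.mk'_eq.1 h).2)

/-- Both sides are inclusions, hence equal; this turns transports into elements of `S` that can be
multiplied. -/
theorem eqToHom_HObj {e f : E S} (h : RG.mk' e = RG.mk' f)
    (h' : (rCone e).HObj = (rCone f).HObj) :
    eqToHom h' = transported e e.1 f (inESF_of_omegaR (RG.mk'_eq.1 h).1) :=
  IsCatWithSubobjects.unique _ _ (eqToHom_isIncl h') (isIncl_transported (RG.mk'_eq.1 h).1)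

/-- Every subobject of `H(r^f; -)` in the normal dual is `H(r^e; -)` for some `e ω^r f`. -/
theorem exists_omegaR_of_isIncl {f : E S} {F : NormalDual (LG S)} (σ : F ⟶ (rCone f).HObj)
    (hσ : IsIncl σ) : ∃ e : E S, omegaR e f ∧ F = (rCone e).HObj := by
  obtain ⟨_, γ, rfl⟩ := F
  obtain ⟨p, rfl⟩ := dualMap_surjective γ (rCone f) σ
  obtain ⟨_, hp⟩ := isIncl_dualMap_iff.1 hσ
  obtain ⟨s, hs⟩ := exists_section_of_epi p
  obtain ⟨h, hh⟩ := LG.exists_rep γ.apex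
  have hu := LG.inESF_val f h rfl hh p
  have hv := LG.inESF_val h f hh rfl s
  have hvu := congrArg (LG.val h hh) hs
  rw [LG.val_comp h f hh rfl, LG.val_id] at hvu
  -- From here on `γ` enters only through `u`: since `γ = r^f * p`, its component at the class of
  -- `g` has value `g f u = g u`.
  have hpu : ∀ (a : LG S) (g : E S) (hg : LG.mk' g = a),
      LG.val g hg (γ.app a) = g.1 * LG.val f rfl p := by
    intro a g hg
    rw [← hp a, LG.val_comp g f hg rfl, LG.val_rCone_app, mul_assoc, hu.left]
  generalize LG.val f rfl p = u at hu hvu hpu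
  generalize LG.val h hh s = v at hv hvu
  have hvuv : v * (u * v) = v := by rw [← mul_assoc, hvu, hv.left]
  have huvu : u * v * u = u := by rw [mul_assoc, hvu, hu.right]
  -- The section relation `v u = h` makes `u` and `v` mutually inverse elements. Hence `u v` is
  -- idempotent, and `u`, `v` give inverse isomorphisms between the classes of `e` and `h`.
  let e : E S := ⟨u * v, by
    change u * v * (u * v) = u * v
    rw [mul_assoc, hvuv]⟩
  have hu' : InESF e u h := InESF.of huvu hu.right
  have hv' : InESF h v e := InESF.of hv.left hvuv
  have h1 : LG.r e u h rfl hh hu' ≫ LG.r h v e hh rfl hv' = 𝟙 _ :=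
    LG.hom_ext e rfl (by rw [LG.r_comp, LG.val_r_self, LG.val_id])
  have h2 : LG.r h v e hh rfl hv' ≫ LG.r e u h rfl hh hu' = 𝟙 _ :=
    LG.hom_ext h hh (by rw [LG.r_comp, LG.val_r_self, LG.val_id, hvu])
  have i1 : IsSplitEpi (LG.r e u h rfl hh hu') := ⟨⟨⟨_, h2⟩⟩⟩
  have i2 : IsSplitEpi (LG.r h v e hh rfl hv') := ⟨⟨⟨_, h1⟩⟩⟩
  refine ⟨e, by change f.1 * (u * v) = u * v; rw [← mul_assoc, hu.left], ?_⟩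
  -- Both cone identities hold on values: `g (u v) u = g u` and `g u v = g (u v)`. The two
  -- H-functors therefore include each other.
  refine IsCatWithSubobjects.strict (dualMap γ (rCone e) (LG.r e u h rfl hh hu'))
    (dualMap (rCone e) γ (LG.r h v e hh rfl hv')) (isIncl_dualMap_iff.2 ⟨?_, fun a => ?_⟩)
    (isIncl_dualMap_iff.2 ⟨?_, fun a => ?_⟩)
  · infer_instance
  · obtain ⟨g, hg⟩ := LG.exists_rep a
    apply LG.hom_ext g hg
    rw [LG.val_comp g e hg rfl, LG.val_rCone_app, LG.val_r_self, hpu, mul_assoc]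
    exact congrArg (g.1 * ·) huvu
  · infer_instance
  · obtain ⟨g, hg⟩ := LG.exists_rep a
    apply LG.hom_ext g hg
    rw [LG.val_comp g h hg hh, LG.val_rCone_app, LG.val_r_self, hpu, mul_assoc]

/-! ### Morphisms and inclusions of `ℛ_G` -/

theorem RG.exists_eq_l {e f : E S} (m : RG.mk' e ⟶ RG.mk' f) : ∃ u hu, m = RG.l e u f hu :=
  ⟨_, RG.inESF_val e f rfl rfl m, (LG.r_val (opE e) (opE f) rfl rfl m).symm⟩

/-- Changing the representative of the domain multiplies on the left in the opposite semigroup,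
hence on the right in `S`. -/
theorem RG.val_l {e f : E S} {u : S} (hu : InESF f u e) (g : E S) (hg : RG.mk' g = RG.mk' e) :
    (LG.val (opE g) hg (RG.l e u f hu)).unop = u * g.1 :=
  congrArg MulOpposite.unop (LG.val_r (opE e) (MulOpposite.op u) (opE f) rfl rfl hu.op (opE g) hg)

theorem RG.eq_l_of_isIncl {e f : E S} {j : RG.mk' e ⟶ RG.mk' f} (hj : IsIncl j) :
    ∃ h : omegaR e f, j = RG.l e e.1 f (inESF_of_omegaR h) := by
  obtain ⟨u, hu, rfl⟩ := RG.exists_eq_l j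
  have hv := congrArg MulOpposite.unop ((LG.isIncl_iff _).1 hj (opE e) rfl)
  rw [RG.val_l hu e rfl, hu.right] at hv
  obtain rfl : u = e.1 := hv
  exact ⟨hu.left, rfl⟩

theorem RG.sub_iff {e f : E S} : Sub (RG.mk' e) (RG.mk' f) ↔ omegaR e f := by
  constructor
  · rintro ⟨j, hj⟩
    exact (RG.eq_l_of_isIncl hj).1
  · refine fun h => ⟨RG.l e e.1 f (inESF_of_omegaR h), (LG.isIncl_iff _).2 fun g hg => ?_⟩
    obtain ⟨g, rfl⟩ := exists_opE g
    exact MulOpposite.unop_injective ((RG.val_l _ g hg).trans (RG.mk'_eq.1 hg).1)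

/-! ### The functor `Γ_G` and the cross-connection -/

variable (S) in
/-- The functor `Γ_G`. -/
def gammaG : RG S ⥤ NormalDual (LG S) where
  obj a := (rCone a.rep).HObj
  map {a b} m := transported a.rep (LG.val (opE a.rep) a.rep_spec m).unop b.rep
    (RG.inESF_val _ _ a.rep_spec b.rep_spec m)
  map_id a := transported_self (inESF_of_omegaR a.rep.2)
  map_comp {a b c} m n := by
    rw [transported_comp]
    exact transported_congr _ _ (congrArg MulOpposite.unop
      (LG.val_comp (opE a.rep) (opE b.rep) a.rep_spec b.rep_spec m n))

theorem isGammaG_gammaG : IsGammaG (gammaG S) where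
  obj_eq e := HObj_rCone_eq (RG.mk' e).rep_spec
  map_eq e u f hu := by
    have he := (RG.mk' e).rep_spec
    have hf := (RG.mk' f).rep_spec
    -- The chosen representatives differ from `e` and `f` only within their `ℛ`-classes. Once the
    -- transports are written as elements of `S`, the right side is the product of `f`, `u` and the
    -- representative of the class of `e`; the factor `f` is absorbed by `u`.
    have key : eqToHom (HObj_rCone_eq he) ≫ transported e u f hu ≫
        eqToHom (HObj_rCone_eq hf.symm) = transported _ (u * (RG.mk' e).rep.1) _
          ((RG.val_l hu _ he).subst (motive := fun v => InESF _ v _)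
            (RG.inESF_val _ _ he hf (RG.l e u f hu))) := by
      rw [eqToHom_HObj he, eqToHom_HObj hf.symm, transported_comp, transported_comp]
      exact transported_congr _ _ (by rw [hu.left])
    exact (transported_congr _ _ (RG.val_l hu _ he)).trans key.symm

namespace IsGammaG

variable {Γ : RG S ⥤ NormalDual (LG S)}

/-- Every object of `ℛ_G` is the class of some `e` and every morphism is some `l(e, u, f)`, so the
defining equations leave no freedom. -/
theorem eq_of_isGammaG {Γ' : RG S ⥤ NormalDual (LG S)} (h : IsGammaG Γ) (h' : IsGammaG Γ') :
    Γ = Γ' := by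
  refine CategoryTheory.Functor.ext (fun a => ?_) fun a b m => ?_
  · obtain ⟨e, rfl⟩ := RG.exists_rep a
    rw [h.obj_eq, h'.obj_eq]
  · obtain ⟨e, rfl⟩ := RG.exists_rep a
    obtain ⟨f, rfl⟩ := RG.exists_rep b
    obtain ⟨u, hu, rfl⟩ := RG.exists_eq_l m
    rw [h.map_eq, h'.map_eq]
    simp

theorem map_isIncl (h : IsGammaG Γ) {a b : RG S} (j : a ⟶ b) (hj : IsIncl j) :
    IsIncl (Γ.map j) := by
  obtain ⟨e, rfl⟩ := RG.exists_rep a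
  obtain ⟨f, rfl⟩ := RG.exists_rep b
  obtain ⟨he, rfl⟩ := RG.eq_l_of_isIncl hj
  rw [h.map_eq]
  exact IsCatWithSubobjects.comp_mem _ _ (eqToHom_isIncl _) <|
    IsCatWithSubobjects.comp_mem _ _ (isIncl_transported he) (eqToHom_isIncl _)

theorem full (h : IsGammaG Γ) : Γ.Full where
  map_surjective {a b} σ := by
    obtain ⟨e, rfl⟩ := RG.exists_rep a
    obtain ⟨f, rfl⟩ := RG.exists_rep b
    -- Only after conjugation by the transports does `σ` run between functors of the form `H(r^e;
    -- -)`, where Yoneda applies.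
    obtain ⟨u, hu, e1⟩ := exists_transported
      (eqToHom (h.obj_eq e).symm ≫ σ ≫ eqToHom (h.obj_eq f))
    refine ⟨RG.l e u f hu, ?_⟩
    rw [h.map_eq, ← e1]
    simp

theorem faithful (h : IsGammaG Γ) : Γ.Faithful where
  map_injective {a b} m n hmn := by
    obtain ⟨e, rfl⟩ := RG.exists_rep a
    obtain ⟨f, rfl⟩ := RG.exists_rep b
    obtain ⟨u, hu, rfl⟩ := RG.exists_eq_l m
    obtain ⟨v, hv, rfl⟩ := RG.exists_eq_l n
    rw [h.map_eq, h.map_eq, cancel_epi, cancel_mono] at hmn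
    obtain rfl := transported_injective hmn
    rfl

theorem isLocalIso (h : IsGammaG Γ) : IsLocalIso Γ where
  normal_source := inferInstance
  normal_target := inferInstance
  map_incl := h.map_isIncl
  full := h.full
  faithful := h.faithful
  iso_ideal c := by
    have := h.full
    have := h.faithful
    obtain ⟨f, rfl⟩ := RG.exists_rep c
    refine ⟨⟨?_, ?_⟩, ?_, ?_⟩
    · rintro ⟨a, ha⟩ ⟨b, hb⟩ hab
      obtain ⟨e, rfl⟩ := RG.exists_rep a
      obtain ⟨e', rfl⟩ := RG.exists_rep b
      have hab' : Γ.obj (RG.mk' e) = Γ.obj (RG.mk' e') :=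
        congrArg ObjectProperty.FullSubcategory.obj hab
      rw [h.obj_eq, h.obj_eq] at hab'
      have he := RG.sub_iff.1 ha
      have he' := RG.sub_iff.1 hb
      -- Equality of the images gives inclusions both ways; as `e` and `e'` both lie below `f`,
      -- these force `e ℛ e'`.
      exact ObjectProperty.FullSubcategory.ext (RG.mk'_eq.2
        ⟨omegaR_of_isIncl he he' _ (eqToHom_isIncl hab'),
          omegaR_of_isIncl he' he _ (eqToHom_isIncl hab'.symm)⟩)
    · rintro ⟨F, σ, hσ⟩
      obtain ⟨e, he, rfl⟩ := exists_omegaR_of_isIncl (σ ≫ eqToHom (h.obj_eq f))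
        (IsCatWithSubobjects.comp_mem _ _ hσ (eqToHom_isIncl _))
      exact ⟨⟨RG.mk' e, RG.sub_iff.2 he⟩, ObjectProperty.FullSubcategory.ext (h.obj_eq e)⟩
    -- Full faithfulness passes from `Γ` to its restriction, since ideals are full subcategories.
    · unfold restrictIdeal
      infer_instance
    · unfold restrictIdeal
      infer_instance

theorem isCrossConnection (h : IsGammaG Γ) : IsCrossConnection Γ where
  normal_source := inferInstance
  localIso := h.isLocalIso
  exists_mem_M c := by
    obtain ⟨e, rfl⟩ := LG.exists_rep c
    refine ⟨RG.mk' e, rCone e, by rw [h.obj_eq], ?_⟩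
    have : (rCone e).app (LG.mk' e) = 𝟙 (LG.mk' e) :=
      LG.hom_ext e rfl ((LG.val_rCone_app e _ e rfl).trans e.2)
    change IsIso ((rCone e).app (LG.mk' e))
    rw [this]
    infer_instance

end IsGammaG

end Gamma

end CrossConn

end

/-- For a regular semigroup `S`, the equations `Γ_G(class of e) = H(r^e; -)` and
`Γ_G(l(e, u, f)) = η_{r^e} ℒ_G(r(f, u, e), -) η_{r^f}⁻¹` define a functor from `ℛ_G` to
`N*ℒ_G`, and this functor is a cross-connection. -/
theorem mainTheorem4 (S : Type u) [Semigroup S] [CrossConn.IsRegularSemigroup S] :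
    (∃! Γ : CrossConn.RG S ⥤ CrossConn.NormalDual (CrossConn.LG S), CrossConn.IsGammaG Γ) ∧
      ∀ Γ : CrossConn.RG S ⥤ CrossConn.NormalDual (CrossConn.LG S),
        CrossConn.IsGammaG Γ → CrossConn.IsCrossConnection Γ := by
  exact ⟨⟨CrossConn.gammaG S, CrossConn.isGammaG_gammaG,
    fun _ h => h.eq_of_isGammaG CrossConn.isGammaG_gammaG⟩, fun _ h => h.isCrossConnection⟩
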